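/- Let $n\ge 2$, let $\mathcal H_1,\dots,\mathcal H_n$ be complex Hilbert spaces of finite dimensions $d_i=\dim\mathcal H_i\ge 2$, and let $\mathcal H$ be a complex Hilbert space of dimension $d_1\cdots d_n$. Call two unitary isomorphisms $T_1,T_2:\mathcal H\to\bigotimes_{i=1}^n\mathcal H_i$ equivalent if $T_1T_2^{-1}$ is a product of local unitaries $U_1\otimes\dots\otimes U_n$ and a permutation of the factors (among factors of equal dimension). A tensor product structure (TPS) of $\mathcal H$ is an equivalence class $\mathcal T=[T]$ of such isomorphisms, and for a unitary operator $U$ on $\mathcal H$ we write $U\cdot\mathcal T=[TU]$. For each $i$, consider bases $(O_i^{\alpha})_{0\le\alpha\le d_i^2-1}$ of the space of linear operators on $\mathcal H_i$ with $O_i^0=\mathbf 1$ which are orthonormal for the normalized Hilbert–Schmidt inner product $\langle A,B\rangle=\frac1{d_i}\operatorname{tr}(A^\dagger B)$. A Hermitian operator $\hat H$ on $\mathcal H$ is $1$-local with respect to $\mathcal T=[T]$ if for some choice of such bases, in the expansion $$T\hat HT^{-1}=\sum_{\alpha_1,\dots,\alpha_n}a_{\alpha_1\cdots\alpha_n}\,O_1^{\alpha_1}\otimes\dots\otimes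 O_n^{\alpha_n},$$ every coefficient $a_{\alpha_1\cdots\alpha_n}$ with more than one nonzero index $\alpha_i$ vanishes (this does not depend on the representative $T$). **Proposition 2.5.** Let $\hat H$ be a Hermitian operator on $\mathcal H$ and $\mathcal T_0$ a TPS of $\mathcal H$ such that $\hat H$ is not $1$-local with respect to $\mathcal T_0$. Then the set of TPSs $\{e^{-it\hat H}\cdot\mathcal T_0 : t\in\mathbb R\}$ is uncountable. -/

import Mathlib

open scoped TensorProduct

noncomputable section

namespace HilbertTPS

/-- A Hilbert space isomorphism `T : 𝓗 → ⨂ i, E i`: a linear bijection that is unitary for the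
usual inner product of the tensor product, the sesquilinear form with
`⟪⨂ v i, ⨂ w i⟫ = ∏ i, ⟪v i, w i⟫`.  As the pure tensors span, it is enough to ask for
the preservation of inner products of pure tensors. -/
structure Factorization {n : ℕ} (E : Fin n → Type*) [∀ i, NormedAddCommGroup (E i)]
    [∀ i, InnerProductSpace ℂ (E i)] (𝓗 : Type*) [NormedAddCommGroup 𝓗]
    [InnerProductSpace ℂ 𝓗] where
  /-- The underlying linear bijection. -/
  toLinearEquiv : 𝓗 ≃ₗ[ℂ] (⨂[ℂ] i, E i)
  inner_symm_tprod : ∀ v w : (i : Fin n) → E i,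
    inner ℂ (toLinearEquiv.symm (PiTensorProduct.tprod ℂ v))
      (toLinearEquiv.symm (PiTensorProduct.tprod ℂ w)) = ∏ i, inner ℂ (v i) (w i)

section

variable {n : ℕ} {E : Fin n → Type*} [∀ i, NormedAddCommGroup (E i)]
  [∀ i, InnerProductSpace ℂ (E i)] {𝓗 : Type*} [NormedAddCommGroup 𝓗] [InnerProductSpace ℂ 𝓗]

/-- `T₁ ∼ T₂`: the operator `T₁ T₂⁻¹` is a product of local unitaries and a permutation of the
factors, that is `v₁ ⊗ ⋯ ⊗ vₙ ↦ U₁ v_{σ 1} ⊗ ⋯ ⊗ Uₙ v_{σ n}` with unitaries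
`U i : E (σ i) → E i` (so `σ` can only permute factors of equal dimension). -/
def Factorization.Equivalent (T₁ T₂ : Factorization E 𝓗) : Prop :=
  ∃ (σ : Equiv.Perm (Fin n)) (U : (i : Fin n) → E (σ i) ≃ₗᵢ[ℂ] E i), ∀ v : (i : Fin n) → E i,
    T₁.toLinearEquiv (T₂.toLinearEquiv.symm (PiTensorProduct.tprod ℂ v)) =
      PiTensorProduct.tprod ℂ (fun i => U i (v (σ i)))

/-- The identity unitary between two factors with equal indices. -/
def castFactor {i j : Fin n} (h : i = j) : E i ≃ₗᵢ[ℂ] E j :=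
  h ▸ LinearIsometryEquiv.refl ℂ (E i)

theorem Factorization.Equivalent.refl (T : Factorization E 𝓗) : T.Equivalent T :=
  ⟨1, fun i => LinearIsometryEquiv.refl ℂ (E i), fun v => by
    simp only [LinearEquiv.apply_symm_apply]; rfl⟩

theorem apply_castFactor_symm {σ : Equiv.Perm (Fin n)} (U : (i : Fin n) → E (σ i) ≃ₗᵢ[ℂ] E i)
    (v : (i : Fin n) → E i) {i j : Fin n} (h : j = i) (h' : σ j = σ i) :
    U i (castFactor h' ((U j).symm (v j))) = v i := by
  subst h; exact (U j).apply_symm_apply (v j)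

theorem Factorization.Equivalent.symm {T₁ T₂ : Factorization E 𝓗} (h : T₁.Equivalent T₂) :
    T₂.Equivalent T₁ := by
  obtain ⟨σ, U, hU⟩ := h
  refine ⟨σ.symm, fun i => (U (σ.symm i)).symm.trans
    (castFactor (σ.apply_symm_apply i)), fun v => ?_⟩
  have h1 := hU (fun i => castFactor (σ.apply_symm_apply i) ((U (σ.symm i)).symm (v (σ.symm i))))
  have h2 : (fun i => U i (castFactor (σ.apply_symm_apply (σ i))
      ((U (σ.symm (σ i))).symm (v (σ.symm (σ i)))))) = v := by
    funext i
    exact apply_castFactor_symm U v (σ.symm_apply_apply i) _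
  rw [h2] at h1
  rw [← h1, LinearEquiv.symm_apply_apply, LinearEquiv.apply_symm_apply]
  rfl

theorem Factorization.Equivalent.trans {T₁ T₂ T₃ : Factorization E 𝓗} (h : T₁.Equivalent T₂)
    (h' : T₂.Equivalent T₃) : T₁.Equivalent T₃ := by
  obtain ⟨σ, U, hU⟩ := h
  obtain ⟨τ, V, hV⟩ := h'
  refine ⟨τ * σ, fun i => (V (σ i)).trans (U i), fun v => ?_⟩
  have h1 := hU (fun i => V i (v (τ i)))
  rw [← hV v, LinearEquiv.symm_apply_apply] at h1
  exact h1

/-- The equivalence relation whose classes are the tensor product structures. -/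
instance Factorization.setoid (E : Fin n → Type*) [∀ i, NormedAddCommGroup (E i)]
    [∀ i, InnerProductSpace ℂ (E i)] (𝓗 : Type*) [NormedAddCommGroup 𝓗]
    [InnerProductSpace ℂ 𝓗] : Setoid (Factorization E 𝓗) where
  r := Factorization.Equivalent
  iseqv := ⟨Factorization.Equivalent.refl, Factorization.Equivalent.symm,
    Factorization.Equivalent.trans⟩

/-- The isomorphism `T U`, for a unitary operator `U` on `𝓗`. -/
def Factorization.comp (T : Factorization E 𝓗) (U : 𝓗 ≃ₗᵢ[ℂ] 𝓗) : Factorization E 𝓗 where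
  toLinearEquiv := U.toLinearEquiv.trans T.toLinearEquiv
  inner_symm_tprod v w :=
    (U.symm.inner_map_map _ _).trans (T.inner_symm_tprod v w)

end

/-- A tensor product structure (TPS) on `𝓗` with factors `E i`. -/
def TPS {n : ℕ} (E : Fin n → Type*) [∀ i, NormedAddCommGroup (E i)]
    [∀ i, InnerProductSpace ℂ (E i)] (𝓗 : Type*) [NormedAddCommGroup 𝓗]
    [InnerProductSpace ℂ 𝓗] : Type _ :=
  Quotient (Factorization.setoid E 𝓗)

section

variable {n : ℕ} {E : Fin n → Type*} [∀ i, NormedAddCommGroup (E i)]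
  [∀ i, InnerProductSpace ℂ (E i)] {𝓗 : Type*} [NormedAddCommGroup 𝓗] [InnerProductSpace ℂ 𝓗]

/-- The class `U · 𝒯 = [T U]`, where `𝒯 = [T]`. -/
def TPS.act (U : 𝓗 ≃ₗᵢ[ℂ] 𝓗) (𝒯 : TPS E 𝓗) : TPS E 𝓗 :=
  Quotient.map (fun T : Factorization E 𝓗 => T.comp U) (by
    rintro T₁ T₂ ⟨σ, V, hV⟩
    refine ⟨σ, V, fun v => ?_⟩
    have h : (T₁.comp U).toLinearEquiv ((T₂.comp U).toLinearEquiv.symm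
        (PiTensorProduct.tprod ℂ v)) =
        T₁.toLinearEquiv (U (U.symm (T₂.toLinearEquiv.symm (PiTensorProduct.tprod ℂ v)))) := rfl
    rw [h, U.apply_symm_apply]
    exact hV v) 𝒯

/-- An orthonormal basis `O 0, …, O (d² - 1)` of the operators on a factor `F` of dimension `d`,
with `O 0 = 1`.  Orthonormality is with respect to the Hilbert-Schmidt inner product
normalized so that the identity is a unit vector, `⟪A, B⟫ = tr (A† B) / d`; being `d²` in
number, orthonormal operators form a basis. -/
def IsOperatorBasis (F : Type*) [NormedAddCommGroup F] [InnerProductSpace ℂ F]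
    [FiniteDimensional ℂ F] (O : Fin (Module.finrank ℂ F ^ 2) → (F →ₗ[ℂ] F)) : Prop :=
  (∀ α : Fin (Module.finrank ℂ F ^ 2), (α : ℕ) = 0 → O α = LinearMap.id) ∧
    ∀ α β, LinearMap.trace ℂ F (LinearMap.adjoint (O α) ∘ₗ O β) / (Module.finrank ℂ F : ℂ) =
      if α = β then 1 else 0

/-- `H` is `K`-local with respect to the TPS `𝒯 = [T]`: for some choice of operator bases
`O i` on the factors, the coefficients `a α` of `T H T⁻¹` in the product basis
`O 1 (α 1) ⊗ ⋯ ⊗ O n (α n)` vanish as soon as more than `K` of the indices `α i` are nonzero.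
(This does not depend on the representative `T`.) -/
def TPS.IsLocal [∀ i, FiniteDimensional ℂ (E i)] (K : ℕ) (H : 𝓗 →L[ℂ] 𝓗) (𝒯 : TPS E 𝓗) : Prop :=
  ∃ T : Factorization E 𝓗, (Quotient.mk _ T : TPS E 𝓗) = 𝒯 ∧
    ∃ O : (i : Fin n) → Fin (Module.finrank ℂ (E i) ^ 2) → (E i →ₗ[ℂ] E i),
      (∀ i, IsOperatorBasis (E i) (O i)) ∧
      ∃ a : ((i : Fin n) → Fin (Module.finrank ℂ (E i) ^ 2)) → ℂ,
        T.toLinearEquiv.conj (H : 𝓗 →ₗ[ℂ] 𝓗) =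
          ∑ α, a α • PiTensorProduct.map (fun i => O i (α i)) ∧
        ∀ α, K < (Finset.univ.filter fun i => (α i : ℕ) ≠ 0).card → a α = 0

end

/-- The time evolution unitary `exp (-i t H)` of the Hamiltonian `H`. -/
def timeEvolution {𝓗 : Type*} [NormedAddCommGroup 𝓗] [InnerProductSpace ℂ 𝓗] [CompleteSpace 𝓗]
    (H : 𝓗 →L[ℂ] 𝓗) (hH : IsSelfAdjoint H) (t : ℝ) : 𝓗 ≃ₗᵢ[ℂ] 𝓗 :=
  Unitary.linearIsometryEquiv
    ⟨NormedSpace.exp ((-(Complex.I * (t : ℂ))) • H), by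
      let := NormedAlgebra.restrictScalars ℚ ℂ (𝓗 →L[ℂ] 𝓗)
      apply NormedSpace.exp_mem_unitary_of_mem_skewAdjoint
      rw [skewAdjoint.mem_iff, star_smul, hH.star_eq, ← neg_smul]
      simp⟩

end HilbertTPS

end

open scoped TensorProduct Topology

/-! Suppose only countably many TPSs occur. Then one TPS, with one permutation of the factors,
serves uncountably many times. Such a set of reals accumulates at one of its points, so `exp(-itH)`
is a product of local unitaries for nonzero `t` arbitrarily close to `0`. Conjugation by a product
unitary preserves the algebra of operators on each factor, so differentiating at `t = 0` shows that
`[H, ·]` preserves it too (`commutator_mem_of_frequently_exp_conj_mem`).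

A derivation of a full matrix algebra is inner: on factor `i` it is `[hᵢ, ·]`. Then `H - ∑ hᵢ`
commutes with all one-factor operators and is a scalar (`exists_eq_smul_one_add_sum_onFactor`), so
`H` is `1`-local. -/

/-! ### Derivations of matrix algebras -/

/-- If the commutators of `H` with the image of a full matrix algebra stay in this image, then the
derivation `A ↦ [H, A]` of the matrix algebra is inner. -/
theorem exists_commute_sub_of_commutator_mem_range {R ι : Type*} [Ring R] [Algebra ℂ R]
    [Fintype ι] [DecidableEq ι] [Nonempty ι] (f : Matrix ι ι ℂ →ₐ[ℂ] R) (H : R)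
    (hf : ∀ A, H * f A - f A * H ∈ f.range) : ∃ h, ∀ A, Commute (H - f h) (f A) := by
  obtain ⟨o⟩ := ‹Nonempty ι›
  choose D hD using hf
  -- `D B` is a preimage of `[H, f B]`. Since `∑ₖ eₖₒ eₒₖ = 1`, `f` maps this witness to `H - ∑ₖ
  -- f(eₖₒ) H f(eₒₖ)`, and the averaged sum commutes with the range of `f`.
  refine ⟨∑ k, D (Matrix.single k o 1) * Matrix.single o k 1, fun A => ?_⟩
  have h1 : f (∑ k, D (Matrix.single k o 1) * Matrix.single o k 1) =
      H - ∑ k, f (Matrix.single k o 1) * H * f (Matrix.single o k 1) := by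
    have h2 : ∑ k, f (Matrix.single k o 1) * f (Matrix.single o k 1) = 1 := by
      simp_rw [← map_mul, ← map_sum, Matrix.single_mul_single_same, mul_one]
      rw [← map_one f]
      congr 1
      ext i j
      rcases eq_or_ne i j with rfl | h
      · simp [Matrix.sum_apply, Matrix.single_apply]
      · simp +contextual [Matrix.sum_apply, h]
    rw [map_sum]
    simp_rw [map_mul]
    have h3 : ∀ B, f (D B) = H * f B - f B * H := hD
    simp_rw [h3, sub_mul, Finset.sum_sub_distrib, mul_assoc, ← Finset.mul_sum, h2, mul_one]
  rw [h1, sub_sub_cancel]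
  have hl : ∀ k, A * Matrix.single k o 1 = ∑ j, A j k • Matrix.single j o (1 : ℂ) := by
    intro k
    ext i j
    by_cases h : o = j <;> simp [Matrix.sum_apply, Matrix.mul_apply, Matrix.single_apply, h]
  have hr : ∀ k, Matrix.single o k 1 * A = ∑ j, A k j • Matrix.single o j (1 : ℂ) := by
    intro k
    ext i j
    by_cases h : o = i <;> simp [Matrix.sum_apply, Matrix.mul_apply, Matrix.single_apply, h]
  -- Both products expand to `∑ A j k • f(eⱼₒ) H f(eₒₖ)`, with the two summations in opposite
  -- orders.
  rw [commute_iff_eq, Finset.sum_mul, Finset.mul_sum]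
  simp_rw [mul_assoc, ← map_mul f _ A, ← mul_assoc, ← map_mul f A, hl, hr, map_sum, Finset.mul_sum,
    Finset.sum_mul, map_smul, mul_smul_comm, smul_mul_assoc]
  exact Finset.sum_comm

theorem exists_commute_sub_of_commutator_mem_range_end {R V : Type*} [Ring R] [Algebra ℂ R]
    [AddCommGroup V] [Module ℂ V] [FiniteDimensional ℂ V] [Nontrivial V]
    (f : (V →ₗ[ℂ] V) →ₐ[ℂ] R) (H : R) (hf : ∀ A, H * f A - f A * H ∈ f.range) :
    ∃ h, ∀ A, Commute (H - f h) (f A) := by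
  have : Nonempty (Fin (Module.finrank ℂ V)) := ⟨⟨0, Module.finrank_pos⟩⟩
  let m := (LinearMap.toMatrixAlgEquiv (Module.finBasis ℂ V)).symm
  obtain ⟨h, hh⟩ := exists_commute_sub_of_commutator_mem_range
    (f.comp m.toAlgHom) H (fun A => by
      obtain ⟨B, hB⟩ := hf (m A)
      exact ⟨m.symm B, by simpa using hB⟩)
  exact ⟨m h, fun A => by simpa using hh (m.symm A)⟩

/-! ### Uncountable sets and one-parameter groups -/

/-- An uncountable set of reals accumulates at one of its points. -/
theorem exists_mem_accPt_of_not_countable {S : Set ℝ} (hS : ¬ S.Countable) :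
    ∃ x ∈ S, AccPt x (Filter.principal S) := by
  by_contra! h
  have : DiscreteTopology S := discreteTopology_subtype_iff.2 fun x hx => by
    simpa [AccPt, Filter.neBot_iff] using h x hx
  exact hS (Set.countable_coe_iff.1 (TopologicalSpace.separableSpace_iff_countable.1 inferInstance))

/-- If a map takes countably many values on an uncountable set, one of its fibers in this set is
uncountable. -/
theorem exists_not_countable_preimage {α β : Type*} {S : Set α} (hS : ¬ S.Countable) {f : α → β}
    (hf : (f '' S).Countable) : ∃ b, ¬ (S ∩ f ⁻¹' {b}).Countable := by
  by_contra! h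
  refine hS ((hf.biUnion fun b _ => h b).mono fun a ha => ?_)
  simp only [Set.mem_iUnion]
  exact ⟨f a, ⟨a, ha, rfl⟩, ha, rfl⟩

/-- If, for `z` accumulating at `0`, conjugation by `exp (z • X)` maps `A` into a
finite-dimensional subspace containing `A`, then this subspace contains the commutator `[X, A]`. -/
theorem commutator_mem_of_frequently_exp_conj_mem {R : Type*} [NormedRing R] [NormedAlgebra ℂ R]
    [CompleteSpace R] (S : Submodule ℂ R) [FiniteDimensional ℂ S] (X A : R) (hA : A ∈ S)
    (h : ∃ᶠ z in 𝓝[≠] (0 : ℂ), ∃ B ∈ S,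
      NormedSpace.exp (z • X) * A = B * NormedSpace.exp (z • X)) :
    X * A - A * X ∈ S := by
  let := NormedAlgebra.restrictScalars ℚ ℂ R
  -- The derivative of `exp(zX) A exp(-zX)` at `0` is `[X, A]`. Its difference quotients at the
  -- given `z` lie in `S`, which is closed.
  have h1 := hasDerivAt_exp_smul_const (𝕂 := ℂ) X (0 : ℂ)
  have h2 := hasDerivAt_exp_smul_const (𝕂 := ℂ) (-X) (0 : ℂ)
  have h3 := (h1.mul_const A).mul h2
  simp only [zero_smul, NormedSpace.exp_zero, one_mul, mul_one, mul_neg] at h3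
  rw [hasDerivAt_iff_tendsto_slope, ← sub_eq_add_neg] at h3
  refine (Submodule.closed_of_finiteDimensional S).mem_of_frequently_of_tendsto
    (h.mono ?_) h3
  rintro z ⟨B, hB, hz⟩
  have h4 : NormedSpace.exp (z • X) * NormedSpace.exp (z • -X) = 1 := by
    rw [smul_neg, ← NormedSpace.exp_add_of_commute (Commute.refl _).neg_right, add_neg_cancel,
      NormedSpace.exp_zero]
  simp only [slope, vsub_eq_sub, Pi.mul_apply, SetLike.mem_coe]
  refine S.smul_mem _ (S.sub_mem ?_ ?_)
  · rwa [hz, mul_assoc, h4, mul_one]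
  · simpa using hA

open scoped InnerProductSpace

namespace HilbertTPS

/-! ### Operator bases -/

/-- An operator basis exists, and it spans. -/
theorem exists_isOperatorBasis (F : Type*) [NormedAddCommGroup F] [InnerProductSpace ℂ F]
    [FiniteDimensional ℂ F] [Nontrivial F] :
    ∃ O : Fin (Module.finrank ℂ F ^ 2) → (F →ₗ[ℂ] F),
      IsOperatorBasis F O ∧ Submodule.span ℂ (Set.range O) = ⊤ := by
  set d := Module.finrank ℂ F with hd
  have hd0 : 0 < d := Module.finrank_pos
  have hdc : (d : ℂ) ≠ 0 := by exact_mod_cast hd0.ne'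
  set r : ℝ := √d
  have hr : (r : ℂ) * r = d := by
    rw [← Complex.ofReal_mul, Real.mul_self_sqrt (Nat.cast_nonneg d), Complex.ofReal_natCast]
  have hr0 : (r : ℂ) ≠ 0 := fun h => hdc (by rw [← hr, h, zero_mul])
  let b := stdOrthonormalBasis ℂ F
  -- Matrix entries scaled by `1/√d` turn the normalized Hilbert–Schmidt product into the Euclidean
  -- one. The identity becomes a unit vector, which extends to an orthonormal basis.
  let φ : (F →ₗ[ℂ] F) →ₗ[ℂ] EuclideanSpace ℂ (Fin d × Fin d) :=
    { toFun A := WithLp.toLp 2 fun p => (r : ℂ)⁻¹ * ⟪b p.1, A (b p.2)⟫_ℂ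
      map_add' A B := by ext p; simp [mul_add]
      map_smul' c A := by ext p; simp; ring }
  have hφ : ∀ A B, ⟪φ A, φ B⟫_ℂ = LinearMap.trace ℂ F (LinearMap.adjoint A ∘ₗ B) / (d : ℂ) := by
    intro A B
    rw [LinearMap.trace_eq_sum_inner _ b, PiLp.inner_apply, Fintype.sum_prod_type_right,
      Finset.sum_div]
    refine Finset.sum_congr rfl fun j _ => ?_
    rw [LinearMap.comp_apply, LinearMap.adjoint_inner_right, ← b.sum_inner_mul_inner,
      Finset.sum_div]
    refine Finset.sum_congr rfl fun i _ => ?_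
    simp only [φ, LinearMap.coe_mk, AddHom.coe_mk, RCLike.inner_apply, map_mul, map_inv₀,
      inner_conj_symm, Complex.conj_ofReal]
    rw [← hr]
    field_simp
  have hinj : Function.Injective φ := by
    rw [← LinearMap.ker_eq_bot, LinearMap.ker_eq_bot']
    intro A hA
    refine b.toBasis.ext fun j => InnerProductSpace.ext_inner_left_basis b.toBasis fun i => ?_
    have h := congrArg (fun x : EuclideanSpace ℂ (Fin d × Fin d) => x (i, j)) hA
    simpa [φ, hr0] using h
  have hcard : Module.finrank ℂ (F →ₗ[ℂ] F) =
      Module.finrank ℂ (EuclideanSpace ℂ (Fin d × Fin d)) := by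
    simp [Module.finrank_linearMap, hd]
  let e := LinearMap.linearEquivOfInjective φ hinj hcard
  have he : ∀ x, φ (e.symm x) = x := e.apply_symm_apply
  let z : Fin (d ^ 2) := ⟨0, by positivity⟩
  have hon : Orthonormal ℂ (({z} : Set (Fin (d ^ 2))).domRestrict
      fun _ => φ LinearMap.id) := by
    constructor
    · intro i
      have h : ⟪φ LinearMap.id, φ LinearMap.id⟫_ℂ = 1 := by
        rw [hφ, LinearMap.comp_id, LinearMap.adjoint_id, LinearMap.trace_id, ← hd,
          div_self hdc]
      rw [inner_self_eq_norm_sq_to_K] at h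
      have h' : ‖φ LinearMap.id‖ ^ 2 = 1 := by
        rw [← RCLike.ofReal_inj (K := ℂ)]
        simpa using h
      exact (pow_eq_one_iff_of_nonneg (norm_nonneg _) two_ne_zero).1 h'
    · intro i j hij
      exact absurd (Subsingleton.elim i j) hij
  obtain ⟨B, hB⟩ := hon.exists_orthonormalBasis_extension_of_card_eq (by simp [pow_two])
  refine ⟨fun α => e.symm (B α), ⟨fun α hα => ?_, fun α β => ?_⟩, ?_⟩
  · have h : α = z := Fin.ext hα
    change e.symm (B α) = _
    rw [h, hB z rfl]
    exact e.symm_apply_apply _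
  · rw [← hφ, he, he, orthonormal_iff_ite.1 B.orthonormal]
  · have h : Set.range (fun α => e.symm (B α)) =
        (e.symm : _ →ₗ[ℂ] _) '' Set.range B.toBasis := by
      rw [← Set.range_comp]; simp [Function.comp_def]
    rw [h, Submodule.span_image, B.toBasis.span_eq, Submodule.map_top, LinearEquiv.range]

/-! ### Operators on a single factor -/

section

variable {n : ℕ} {E : Fin n → Type*} [∀ i, NormedAddCommGroup (E i)]
  [∀ i, InnerProductSpace ℂ (E i)]

/-- The operator `1 ⊗ ⋯ ⊗ A ⊗ ⋯ ⊗ 1`, with `A` acting on the factor `i`. -/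
noncomputable def onFactor (i : Fin n) : (E i →ₗ[ℂ] E i) →ₐ[ℂ] ((⨂[ℂ] i, E i) →ₗ[ℂ] (⨂[ℂ] i, E i)) :=
  AlgHom.ofLinearMap ((PiTensorProduct.mapMultilinear ℂ E E).toLinearMap (fun _ => 1) i)
    (by
      simp only [MultilinearMap.toLinearMap_apply, PiTensorProduct.mapMultilinear_apply]
      rw [show Function.update (fun _ => 1) i 1 = (fun i => (1 : E i →ₗ[ℂ] E i)) from
        Function.update_eq_self i _]
      exact PiTensorProduct.map_one)
    (fun A B => by
      simp only [MultilinearMap.toLinearMap_apply, PiTensorProduct.mapMultilinear_apply]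
      rw [← PiTensorProduct.map_mul]
      congr 1
      funext j
      rcases eq_or_ne j i with rfl | h <;> simp [*])

theorem onFactor_apply (i : Fin n) (A : E i →ₗ[ℂ] E i) :
    onFactor i A = PiTensorProduct.map (Function.update (fun _ => LinearMap.id) i A) := rfl

theorem onFactor_tprod (i : Fin n) (A : E i →ₗ[ℂ] E i) (v : (i : Fin n) → E i) :
    onFactor i A (PiTensorProduct.tprod ℂ v) =
      PiTensorProduct.tprod ℂ (Function.update v i (A (v i))) := by
  rw [onFactor_apply, PiTensorProduct.map_tprod]
  congr 1
  funext j
  rcases eq_or_ne j i with rfl | h <;> simp [*]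

theorem commute_onFactor {i j : Fin n} (h : i ≠ j) (A : E i →ₗ[ℂ] E i) (B : E j →ₗ[ℂ] E j) :
    Commute (onFactor i A) (onFactor j B) := by
  refine PiTensorProduct.ext (MultilinearMap.ext fun v => ?_)
  simp only [LinearMap.compMultilinearMap_apply, Module.End.mul_apply, onFactor_tprod]
  rw [Function.update_of_ne h, Function.update_of_ne h.symm, Function.update_comm h]

/-- A product operator is a composition of one-factor operators, built up one factor at a time. -/
theorem commute_map_of_commute_onFactor {K : (⨂[ℂ] i, E i) →ₗ[ℂ] (⨂[ℂ] i, E i)}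
    (hK : ∀ i A, Commute K (onFactor i A)) (f : (i : Fin n) → E i →ₗ[ℂ] E i) :
    Commute K (PiTensorProduct.map f) := by
  have key : ∀ s : Finset (Fin n),
      Commute K (PiTensorProduct.map fun i => if i ∈ s then f i else 1) := by
    intro s
    induction s using Finset.induction_on with
    | empty =>
      simp only [Finset.notMem_empty, if_false]
      rw [PiTensorProduct.map_one]
      exact Commute.one_right K
    | insert i s hi ih =>
      have h : (PiTensorProduct.map fun j => if j ∈ insert i s then f j else 1) =
          onFactor i (f i) * PiTensorProduct.map fun j => if j ∈ s then f j else 1 := by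
        rw [onFactor_apply, ← PiTensorProduct.map_mul]
        congr 1
        funext j
        rcases eq_or_ne j i with rfl | h
        · simp [hi]
        · simp [h, ← Module.End.one_eq_id]
      rw [h]
      exact (hK i (f i)).mul_right ih
  simpa using key Finset.univ

/-- The product of rank-one operators `R v` sends `⊗e` to `⊗v` and commutes with `K`. Taking `v = e`
shows that `⊗e` is an eigenvector of `K`; applying `R v` carries its eigenvalue to every `⊗v`. -/
theorem eq_smul_one_of_commute_onFactor [∀ i, Nontrivial (E i)]
    {K : (⨂[ℂ] i, E i) →ₗ[ℂ] (⨂[ℂ] i, E i)} (hK : ∀ i A, Commute K (onFactor i A)) :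
    ∃ c : ℂ, K = c • 1 := by
  choose e he using fun i => exists_ne (0 : E i)
  let R (v : (i : Fin n) → E i) (i : Fin n) : E i →ₗ[ℂ] E i :=
    ((⟪e i, e i⟫_ℂ)⁻¹ • (innerₛₗ ℂ (e i))).smulRight (v i)
  have hR : ∀ v w, PiTensorProduct.map (R v) (PiTensorProduct.tprod ℂ w) =
      (∏ i, (⟪e i, e i⟫_ℂ)⁻¹ * ⟪e i, w i⟫_ℂ) • PiTensorProduct.tprod ℂ v := by
    intro v w
    rw [PiTensorProduct.map_tprod, ← MultilinearMap.map_smul_univ]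
    rfl
  have hRe : ∀ v, PiTensorProduct.map (R v) (PiTensorProduct.tprod ℂ e) =
      PiTensorProduct.tprod ℂ v := by
    intro v
    rw [hR, Finset.prod_eq_one, one_smul]
    exact fun i _ => inv_mul_cancel₀ (inner_self_ne_zero.2 (he i))
  have hc : ∀ x, ∃ c : ℂ, PiTensorProduct.map (R e) x = c • PiTensorProduct.tprod ℂ e := by
    intro x
    induction x using PiTensorProduct.induction_on with
    | smul_tprod r w => exact ⟨_, by rw [map_smul, hR, smul_smul]⟩
    | add x y hx hy =>
      obtain ⟨c, hc⟩ := hx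
      obtain ⟨c', hc'⟩ := hy
      exact ⟨c + c', by rw [map_add, hc, hc', add_smul]⟩
  have hcomm : ∀ v x, K (PiTensorProduct.map (R v) x) = PiTensorProduct.map (R v) (K x) :=
    fun v x => LinearMap.congr_fun (commute_map_of_commute_onFactor hK (R v)).eq x
  obtain ⟨c, hc⟩ := hc (K (PiTensorProduct.tprod ℂ e))
  refine ⟨c, PiTensorProduct.ext (MultilinearMap.ext fun v => ?_)⟩
  simp only [LinearMap.compMultilinearMap_apply, LinearMap.smul_apply, Module.End.one_apply]
  rw [← hcomm, hRe] at hc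
  rw [← hRe v, hcomm, hc, map_smul]

/-- If the commutators of `K` with the operators on any one factor are operators on this factor,
then `K` is a sum of operators on the single factors, up to a scalar. -/
theorem exists_eq_smul_one_add_sum_onFactor [∀ i, Nontrivial (E i)] [∀ i, FiniteDimensional ℂ (E i)]
    {K : (⨂[ℂ] i, E i) →ₗ[ℂ] (⨂[ℂ] i, E i)}
    (hK : ∀ i A, K * onFactor i A - onFactor i A * K ∈ (onFactor (E := E) i).range) :
    ∃ (c : ℂ) (h : (i : Fin n) → E i →ₗ[ℂ] E i), K = c • 1 + ∑ i, onFactor i (h i) := by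
  choose h hh using fun i => exists_commute_sub_of_commutator_mem_range_end (onFactor i) K (hK i)
  obtain ⟨c, hc⟩ := eq_smul_one_of_commute_onFactor (K := K - ∑ i, onFactor i (h i)) (by
    intro i A
    -- The terms `h j` with `j ≠ i` already commute with factor `i`, so removing them does no harm.
    rw [← Finset.add_sum_erase _ _ (Finset.mem_univ i), ← sub_sub]
    exact (hh i A).sub_left (Commute.sum_left _ _ _ fun j hj =>
      commute_onFactor (Finset.ne_of_mem_erase hj) _ _))
  exact ⟨c, h, by rw [← hc, sub_add_cancel]⟩

/-- A scalar plus a sum of operators on the single factors is `1`-local. -/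
theorem exists_coeff_of_eq_smul_one_add_sum_onFactor [∀ i, FiniteDimensional ℂ (E i)]
    [∀ i, Nontrivial (E i)]
    {O : (i : Fin n) → Fin (Module.finrank ℂ (E i) ^ 2) → (E i →ₗ[ℂ] E i)}
    (hO : ∀ i, IsOperatorBasis (E i) (O i)) (hspan : ∀ i, Submodule.span ℂ (Set.range (O i)) = ⊤)
    (c : ℂ) (h : (i : Fin n) → E i →ₗ[ℂ] E i) :
    ∃ a : ((i : Fin n) → Fin (Module.finrank ℂ (E i) ^ 2)) → ℂ,
      c • 1 + ∑ i, onFactor i (h i) = ∑ α, a α • PiTensorProduct.map (fun i => O i (α i)) ∧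
      ∀ α, 1 < (Finset.univ.filter fun i => (α i : ℕ) ≠ 0).card → a α = 0 := by
  let p (α : (i : Fin n) → Fin (Module.finrank ℂ (E i) ^ 2)) : Prop :=
    1 < (Finset.univ.filter fun i => (α i : ℕ) ≠ 0).card
  let C : Submodule ℂ (((i : Fin n) → Fin (Module.finrank ℂ (E i) ^ 2)) → ℂ) :=
    { carrier := {a | ∀ α, p α → a α = 0}
      add_mem' := fun ha hb α hα => by simp [ha α hα, hb α hα]
      zero_mem' := fun _ _ => rfl
      smul_mem' := fun r a ha α hα => by simp [ha α hα] }
  -- `S` consists of the operators with an admissible expansion. Being a subspace, it need only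
  -- contain `1` and each one-factor operator.
  let S := C.map (Fintype.linearCombination ℂ fun α => PiTensorProduct.map fun i => O i (α i))
  suffices hS : c • 1 + ∑ i, onFactor i (h i) ∈ S by
    obtain ⟨a, ha, haS⟩ := hS
    exact ⟨a, by rw [← haS, Fintype.linearCombination_apply], ha⟩
  have hbasic : ∀ α, ¬ p α → (PiTensorProduct.map fun i => O i (α i)) ∈ S := by
    intro α hα
    refine ⟨Pi.single α 1, fun β hβ => ?_, by
      rw [Fintype.linearCombination_apply_single, one_smul]⟩
    exact Pi.single_eq_of_ne (by rintro rfl; exact hα hβ) _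
  let z (i : Fin n) : Fin (Module.finrank ℂ (E i) ^ 2) := ⟨0, pow_pos Module.finrank_pos 2⟩
  have hz : ∀ i, O i (z i) = LinearMap.id := fun i => (hO i).1 _ rfl
  have hone : 1 ∈ S := by
    have h1 := hbasic z (by simp [p, z])
    simp_rw [hz] at h1
    rwa [PiTensorProduct.map_id] at h1
  have hfac : ∀ i A, onFactor i A ∈ S := by
    intro i A
    have hA : A ∈ Submodule.span ℂ (Set.range (O i)) := hspan i ▸ Submodule.mem_top
    have hle : Submodule.span ℂ (Set.range (O i)) ≤ S.comap (onFactor i).toLinearMap := by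
      rw [Submodule.span_le]
      rintro _ ⟨β, rfl⟩
      have h1 := hbasic (Function.update z i β) (by
        simp only [p, not_lt]
        refine (Finset.card_le_card (t := {i}) fun j hj => ?_).trans (Finset.card_singleton i).le
        by_contra hji
        simp only [Finset.mem_singleton] at hji
        simp [hji, z] at hj)
      have h2 : (fun j => O j (Function.update z i β j)) =
          Function.update (fun _ => LinearMap.id) i (O i β) := by
        funext j
        rcases eq_or_ne j i with rfl | hj
        · simp
        · simp [hj, hz]
      rw [h2] at h1
      exact h1
    exact hle hA
  exact S.add_mem (S.smul_mem _ hone) (S.sum_mem fun i _ => hfac i _)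

end

/-! ### Product unitaries -/

section

variable {n : ℕ} {E : Fin n → Type*} [∀ i, NormedAddCommGroup (E i)]
  [∀ i, InnerProductSpace ℂ (E i)] {𝓗 : Type*} [NormedAddCommGroup 𝓗] [InnerProductSpace ℂ 𝓗]

/-- `W` is a product of local unitaries with respect to `T`. -/
def Factorization.IsProductUnitary (T : Factorization E 𝓗) (W : 𝓗 →L[ℂ] 𝓗) : Prop :=
  ∃ U : (i : Fin n) → E i ≃ₗᵢ[ℂ] E i, ∀ v : (i : Fin n) → E i,
    T.toLinearEquiv (W (T.toLinearEquiv.symm (PiTensorProduct.tprod ℂ v))) =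
      PiTensorProduct.tprod ℂ fun i => U i (v i)

/-- Two unitaries which agree up to product unitaries and the same permutation of the factors
with a fixed unitary differ by a product unitary. -/
theorem Factorization.isProductUnitary_of_comp (T : Factorization E 𝓗)
    {V V' V₀ : 𝓗 ≃ₗᵢ[ℂ] 𝓗} {σ : Equiv.Perm (Fin n)} {U U' : (i : Fin n) → E (σ i) ≃ₗᵢ[ℂ] E i}
    (hU : ∀ v : (i : Fin n) → E i, (T.comp V).toLinearEquiv ((T.comp V₀).toLinearEquiv.symm
      (PiTensorProduct.tprod ℂ v)) = PiTensorProduct.tprod ℂ fun i => U i (v (σ i)))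
    (hU' : ∀ v : (i : Fin n) → E i, (T.comp V').toLinearEquiv ((T.comp V₀).toLinearEquiv.symm
      (PiTensorProduct.tprod ℂ v)) = PiTensorProduct.tprod ℂ fun i => U' i (v (σ i)))
    {W : 𝓗 →L[ℂ] 𝓗} (hW : ∀ x, W (V' x) = V x) : T.IsProductUnitary W := by
  refine ⟨fun i => (U' i).symm.trans (U i), fun v => ?_⟩
  -- `w` is chosen so that permuting by `σ` and applying `U'` returns `v`; the common permutation
  -- then cancels.
  let w : (i : Fin n) → E i := fun i =>
    castFactor (σ.apply_symm_apply i) ((U' (σ.symm i)).symm (v (σ.symm i)))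
  have hw : ∀ i, w (σ i) = (U' i).symm (v i) := by
    intro i
    apply (U' i).injective
    rw [LinearIsometryEquiv.apply_symm_apply]
    exact apply_castFactor_symm U' v (σ.symm_apply_apply i) _
  have h' := hU' w
  have h := hU w
  simp only [hw, LinearIsometryEquiv.apply_symm_apply] at h h'
  change T.toLinearEquiv (V' _) = _ at h'
  change T.toLinearEquiv (V _) = _ at h
  rw [← h', LinearEquiv.symm_apply_apply, hW]
  exact h

/-- Here `B = Uᵢ A Uᵢ⁻¹`; the intertwining form avoids inverting `W`. -/
theorem Factorization.IsProductUnitary.conj_onFactor {T : Factorization E 𝓗} {W : 𝓗 →L[ℂ] 𝓗}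
    (hW : T.IsProductUnitary W) (i : Fin n) (A : E i →ₗ[ℂ] E i) :
    ∃ B : E i →ₗ[ℂ] E i, T.toLinearEquiv.conj (W : 𝓗 →ₗ[ℂ] 𝓗) * onFactor i A =
      onFactor i B * T.toLinearEquiv.conj (W : 𝓗 →ₗ[ℂ] 𝓗) := by
  obtain ⟨U, hU⟩ := hW
  have h : ∀ v, T.toLinearEquiv.conj (W : 𝓗 →ₗ[ℂ] 𝓗) (PiTensorProduct.tprod ℂ v) =
      PiTensorProduct.tprod ℂ fun i => U i (v i) := hU
  refine ⟨(U i).toLinearEquiv.conj A, PiTensorProduct.ext (MultilinearMap.ext fun v => ?_)⟩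
  simp only [LinearMap.compMultilinearMap_apply, Module.End.mul_apply, onFactor_tprod, h]
  congr 1
  funext j
  rcases eq_or_ne j i with rfl | hj
  · simp [LinearEquiv.conj_apply]
  · simp [hj]

end

/-! ### Time evolution -/

theorem timeEvolution_apply {𝓗 : Type*} [NormedAddCommGroup 𝓗] [InnerProductSpace ℂ 𝓗]
    [CompleteSpace 𝓗] (H : 𝓗 →L[ℂ] 𝓗) (hH : IsSelfAdjoint H) (t : ℝ) (x : 𝓗) :
    timeEvolution H hH t x = NormedSpace.exp ((t : ℂ) • (-Complex.I • H)) x := by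
  rw [smul_smul, mul_neg, mul_comm]
  rfl

theorem exp_sub_smul_timeEvolution_apply {𝓗 : Type*} [NormedAddCommGroup 𝓗]
    [InnerProductSpace ℂ 𝓗] [CompleteSpace 𝓗] (H : 𝓗 →L[ℂ] 𝓗) (hH : IsSelfAdjoint H) (t s : ℝ)
    (x : 𝓗) : NormedSpace.exp (((t - s : ℝ) : ℂ) • (-Complex.I • H)) (timeEvolution H hH s x) =
      timeEvolution H hH t x := by
  let := NormedAlgebra.restrictScalars ℚ ℂ (𝓗 →L[ℂ] 𝓗)
  rw [timeEvolution_apply, timeEvolution_apply, ← mul_apply_eq_comp,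
    ← NormedSpace.exp_add_of_commute, ← add_smul]
  · simp
  · exact ((Commute.refl _).smul_left _).smul_right _

/-- If countably many tensor product structures occur along the time evolution, then the evolution
operator is a product unitary at arbitrarily small nonzero times. -/
theorem frequently_isProductUnitary_of_countable {n : ℕ} {E : Fin n → Type*}
    [∀ i, NormedAddCommGroup (E i)] [∀ i, InnerProductSpace ℂ (E i)] {𝓗 : Type*}
    [NormedAddCommGroup 𝓗] [InnerProductSpace ℂ 𝓗] [CompleteSpace 𝓗] (H : 𝓗 →L[ℂ] 𝓗)
    (hH : IsSelfAdjoint H) (T : Factorization E 𝓗)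
    (hc : (Set.range fun t : ℝ =>
      TPS.act (timeEvolution H hH t) (Quotient.mk _ T : TPS E 𝓗)).Countable) :
    ∃ᶠ t : ℝ in 𝓝[≠] (0 : ℝ), T.IsProductUnitary (NormedSpace.exp ((t : ℂ) • (-Complex.I • H))) := by
  rw [← Set.image_univ] at hc
  obtain ⟨𝒯, hS⟩ := exists_not_countable_preimage Set.not_countable_univ hc
  set S := Set.univ ∩ (fun t : ℝ =>
    TPS.act (timeEvolution H hH t) (Quotient.mk _ T : TPS E 𝓗)) ⁻¹' {𝒯}
  obtain ⟨s, hs⟩ : S.Nonempty := by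
    rw [Set.nonempty_iff_ne_empty]
    intro h
    exact hS (h ▸ Set.countable_empty)
  have hequiv : ∀ t ∈ S,
      (T.comp (timeEvolution H hH t)).Equivalent (T.comp (timeEvolution H hH s)) := by
    intro t ht
    have h : (Quotient.mk _ (T.comp (timeEvolution H hH t)) : TPS E 𝓗) =
      Quotient.mk _ (T.comp (timeEvolution H hH s)) := ht.2.trans hs.2.symm
    exact Quotient.exact h
  choose! σ U hU using hequiv
  -- A second pigeonhole, over the finitely many permutations.
  obtain ⟨τ, hP⟩ := exists_not_countable_preimage hS (f := σ) (Set.to_countable _)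
  obtain ⟨t₀, ht₀, hacc⟩ := exists_mem_accPt_of_not_countable hP
  rw [accPt_iff_frequently_nhdsNE] at hacc
  have htend : Filter.Tendsto (fun t => t - t₀) (𝓝[≠] t₀) (𝓝[≠] 0) := by
    refine tendsto_nhdsWithin_iff.2 ⟨?_, ?_⟩
    · have h : Filter.Tendsto (fun t => t - t₀) (𝓝 t₀) (𝓝 (t₀ - t₀)) :=
        (continuous_id.sub continuous_const).tendsto t₀
      rw [sub_self] at h
      exact h.mono_left nhdsWithin_le_nhds
    · filter_upwards [self_mem_nhdsWithin] with t ht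
      exact sub_ne_zero.2 ht
  refine htend.frequently (hacc.mono fun t ht => ?_)
  have key : ∀ t ∈ S ∩ σ ⁻¹' {τ}, ∃ U : (i : Fin n) → E (τ i) ≃ₗᵢ[ℂ] E i,
      ∀ v : (i : Fin n) → E i, (T.comp (timeEvolution H hH t)).toLinearEquiv
        ((T.comp (timeEvolution H hH s)).toLinearEquiv.symm (PiTensorProduct.tprod ℂ v)) =
          PiTensorProduct.tprod ℂ fun i => U i (v (τ i)) := by
    rintro t ⟨htS, rfl⟩
    exact ⟨U t htS, hU t htS⟩
  obtain ⟨V, hV⟩ := key t ht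
  obtain ⟨V', hV'⟩ := key t₀ ht₀
  exact T.isProductUnitary_of_comp hV hV' (exp_sub_smul_timeEvolution_apply H hH t t₀)

/-- The infinitesimal form of invariance under conjugation. The algebra of factor `i` is pulled back
to the normed algebra of operators on `𝓗`, where the exponential is differentiated. -/
theorem commutator_mem_range_onFactor_of_frequently {n : ℕ} {E : Fin n → Type*}
    [∀ i, NormedAddCommGroup (E i)] [∀ i, InnerProductSpace ℂ (E i)] {𝓗 : Type*}
    [NormedAddCommGroup 𝓗] [InnerProductSpace ℂ 𝓗] [FiniteDimensional ℂ 𝓗] [CompleteSpace 𝓗]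
    (H : 𝓗 →L[ℂ] 𝓗) (T : Factorization E 𝓗)
    (hT : ∃ᶠ t : ℝ in 𝓝[≠] (0 : ℝ),
      T.IsProductUnitary (NormedSpace.exp ((t : ℂ) • (-Complex.I • H))))
    (i : Fin n) (A : E i →ₗ[ℂ] E i) :
    T.toLinearEquiv.conj (H : 𝓗 →ₗ[ℂ] 𝓗) * onFactor i A -
      onFactor i A * T.toLinearEquiv.conj (H : 𝓗 →ₗ[ℂ] 𝓗) ∈ (onFactor (E := E) i).range := by
  let g : (𝓗 →L[ℂ] 𝓗) ≃ₐ[ℂ] ((⨂[ℂ] i, E i) →ₗ[ℂ] (⨂[ℂ] i, E i)) :=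
    (Module.End.toContinuousLinearMap 𝓗).symm.trans (T.toLinearEquiv.conjAlgEquiv ℂ)
  have hg : ∀ B : 𝓗 →L[ℂ] 𝓗, g B = T.toLinearEquiv.conj (B : 𝓗 →ₗ[ℂ] 𝓗) := fun _ => rfl
  let S : Submodule ℂ (𝓗 →L[ℂ] 𝓗) :=
    (onFactor (E := E) i).range.toSubmodule.comap (g : _ →ₐ[ℂ] _).toLinearMap
  have hS : ∀ B, B ∈ S ↔ g B ∈ (onFactor (E := E) i).range := fun _ => Iff.rfl
  have htend : Filter.Tendsto (fun t : ℝ => (t : ℂ)) (𝓝[≠] 0) (𝓝[≠] 0) :=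
    tendsto_nhdsWithin_iff.2 ⟨(Complex.continuous_ofReal.tendsto' 0 0
      Complex.ofReal_zero).mono_left nhdsWithin_le_nhds, by
        filter_upwards [self_mem_nhdsWithin] with t ht
        exact Complex.ofReal_ne_zero.2 ht⟩
  have h := commutator_mem_of_frequently_exp_conj_mem S (-Complex.I • H) (g.symm (onFactor i A))
    ((hS _).2 ⟨A, (g.apply_symm_apply _).symm⟩) (htend.frequently (hT.mono fun t ht => by
      obtain ⟨B, hB⟩ := ht.conj_onFactor i A
      refine ⟨g.symm (onFactor i B), (hS _).2 ⟨B, (g.apply_symm_apply _).symm⟩, g.injective ?_⟩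
      rw [map_mul, map_mul, g.apply_symm_apply, g.apply_symm_apply, hg]
      exact hB))
  -- The factor `i` turns `[-iH, A]` into `[H, A]`.
  have h' := S.smul_mem Complex.I h
  rw [hS, smul_mul_assoc, mul_smul_comm, ← smul_sub, smul_smul, mul_neg, Complex.I_mul_I, neg_neg,
    one_smul, map_sub, map_mul, map_mul, g.apply_symm_apply, hg] at h'
  exact h'

end HilbertTPS

open HilbertTPS in
theorem proposition2p5 {n : ℕ} (hn : 2 ≤ n)
    (E : Fin n → Type*) [∀ i, NormedAddCommGroup (E i)] [∀ i, InnerProductSpace ℂ (E i)]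
    [∀ i, FiniteDimensional ℂ (E i)] (hE : ∀ i, 2 ≤ Module.finrank ℂ (E i))
    (𝓗 : Type*) [NormedAddCommGroup 𝓗] [InnerProductSpace ℂ 𝓗] [FiniteDimensional ℂ 𝓗]
    [CompleteSpace 𝓗]
    (H : 𝓗 →L[ℂ] 𝓗) (hH : IsSelfAdjoint H) (𝒯₀ : TPS E 𝓗) (hloc : ¬ 𝒯₀.IsLocal 1 H) :
    ¬ (Set.range fun t : ℝ => TPS.act (timeEvolution H hH t) 𝒯₀).Countable := by
  intro hc
  refine hloc ?_
  obtain ⟨T, rfl⟩ := Quotient.exists_rep 𝒯₀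
  have : ∀ i, Nontrivial (E i) := fun i =>
    Module.nontrivial_of_finrank_pos (R := ℂ) (zero_lt_two.trans_le (hE i))
  choose O hO hspan using fun i => exists_isOperatorBasis (E i)
  obtain ⟨c, h, hK⟩ := exists_eq_smul_one_add_sum_onFactor
    (commutator_mem_range_onFactor_of_frequently H T
      (frequently_isProductUnitary_of_countable H hH T hc))
  obtain ⟨a, ha, hloc⟩ := exists_coeff_of_eq_smul_one_add_sum_onFactor hO hspan c h
  exact ⟨T, rfl, O, hO, a, hK.trans ha, hloc⟩
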